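/- Let $\mathbb F_q$ be a finite field of characteristic $p$ with algebraic closure $\overline{\mathbb F}_q$, and let $E$ be an elliptic curve over $\mathbb F_q$ given by $Y^2 = X^3 + aX + b$ with $a, b \in \mathbb F_q$. Suppose that $E$ is ordinary, that is, the group $E[p]$ of points $P \in E(\overline{\mathbb F}_q)$ with $pP = O$ is isomorphic to $\mathbb Z/p\mathbb Z$, and that $b \neq 0$. For an integer $n \ge 0$ let $\psi_n$ be the $n$-th division polynomial of $E$ and, for $n \ge 1$, let $f_n, g_n \in \mathbb F_q[X]$ be the polynomials $$f_n = X\psi_n^2 - \psi_{n-1}\psi_{n+1}, \qquad g_n = \psi_n^2,$$ where the right-hand sides are reduced to polynomials in $X$ alone by means of the equation $Y^2 = X^3 + aX + b$. Then for all distinct positive integers $m$ and $n$, neither of the rational functions $$\Phi_{m,n} = \frac{f_m f_n}{g_m g_n}, \qquad \Psi_{m,n} = \frac{(X^3 + aX + b) f_m f_n}{g_m g_n}$$ is the square of a rational function in $\overline{\mathbb F}_q(X)$. -/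

import Mathlib

open Polynomial
open scoped Polynomial.Bivariate

namespace EllDivPoly

/-- The Weierstrass curve `Y² = X³ + aX + b`. -/
def curve {F : Type*} [Field F] (a b : F) : WeierstrassCurve F :=
  ⟨0, 0, 0, a, b⟩

open scoped Classical in
/-- An elliptic curve `E` over a finite field `F` of characteristic `p` is ordinary if the group
`E[p]` of `p`-torsion points over the algebraic closure of `F` is isomorphic to `ℤ/pℤ`. -/
def IsOrdinary {F : Type*} [Field F] (E : WeierstrassCurve F) : Prop :=
  Nonempty (Submodule.torsionBy ℤ (WeierstrassCurve.Affine.Point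
    (E.map (algebraMap F (AlgebraicClosure F))).toAffine) (ringChar F : ℤ) ≃+ ZMod (ringChar F))

/-- The polynomial `f_n = X ψ_n² - ψ_{n-1} ψ_{n+1}` as an element of `F[X]`, where `ψ_n` is the
`n`-th division polynomial of `Y² = X³ + aX + b`; see `mk_f` and `eq_f_iff`. -/
noncomputable def f {F : Type*} [Field F] (a b : F) (n : ℕ) : F[X] :=
  (curve a b).Φ n

/-- The polynomial `g_n = ψ_n²` as an element of `F[X]`; see `mk_g` and `eq_g_iff`. -/
noncomputable def g {F : Type*} [Field F] (a b : F) (n : ℕ) : F[X] :=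
  (curve a b).ΨSq n

open WeierstrassCurve.Affine in
/-- `f_n = X ψ_n² - ψ_{n-1} ψ_{n+1}` modulo the equation of the curve. -/
theorem mk_f {F : Type*} [Field F] (a b : F) (n : ℕ) :
    CoordinateRing.mk (curve a b) (C (f a b n)) =
      CoordinateRing.mk (curve a b) (C X * (curve a b).ψ n ^ 2 -
        (curve a b).ψ ((n : ℤ) - 1) * (curve a b).ψ ((n : ℤ) + 1)) := by
  rw [f, ← CoordinateRing.mk_φ, WeierstrassCurve.φ, mul_comm ((curve a b).ψ ((n : ℤ) - 1))]

open WeierstrassCurve.Affine in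
/-- `g_n = ψ_n²` modulo the equation of the curve. -/
theorem mk_g {F : Type*} [Field F] (a b : F) (n : ℕ) :
    CoordinateRing.mk (curve a b) (C (g a b n)) =
      CoordinateRing.mk (curve a b) ((curve a b).ψ n ^ 2) := by
  rw [g, map_pow, CoordinateRing.mk_ψ, CoordinateRing.mk_Ψ_sq]

open WeierstrassCurve.Affine in
/-- A polynomial in `X` is determined by its class modulo the equation of the curve. -/
theorem mk_C_injective {F : Type*} [Field F] (a b : F) :
    Function.Injective fun p : F[X] => CoordinateRing.mk (curve a b) (C p) :=
  FaithfulSMul.algebraMap_injective F[X] (CoordinateRing (curve a b))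

open WeierstrassCurve.Affine in
/-- `f_n` is the only polynomial in `X` congruent to `X ψ_n² - ψ_{n-1} ψ_{n+1}`. -/
theorem eq_f_iff {F : Type*} [Field F] (a b : F) (n : ℕ) (p : F[X]) :
    p = f a b n ↔ CoordinateRing.mk (curve a b) (C p) =
      CoordinateRing.mk (curve a b) (C X * (curve a b).ψ n ^ 2 -
        (curve a b).ψ ((n : ℤ) - 1) * (curve a b).ψ ((n : ℤ) + 1)) := by
  rw [← mk_f]
  exact (mk_C_injective a b).eq_iff.symm

open WeierstrassCurve.Affine in
/-- `g_n` is the only polynomial in `X` congruent to `ψ_n²`. -/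
theorem eq_g_iff {F : Type*} [Field F] (a b : F) (n : ℕ) (p : F[X]) :
    p = g a b n ↔ CoordinateRing.mk (curve a b) (C p) =
      CoordinateRing.mk (curve a b) ((curve a b).ψ n ^ 2) := by
  rw [← mk_g]
  exact (mk_C_injective a b).eq_iff.symm

/-- The inclusion of `F[X]` into the field of rational functions over the algebraic closure. -/
noncomputable def toRat (F : Type*) [Field F] : F[X] →+* RatFunc (AlgebraicClosure F) :=
  (algebraMap (AlgebraicClosure F)[X] (RatFunc (AlgebraicClosure F))).comp
    (mapRingHom (algebraMap F (AlgebraicClosure F)))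

/-- The rational function `Φ_{m,n} = f_m f_n / (g_m g_n)`. -/
noncomputable def Phi {F : Type*} [Field F] (a b : F) (m n : ℕ) :
    RatFunc (AlgebraicClosure F) :=
  toRat F (f a b m * f a b n) / toRat F (g a b m * g a b n)

/-- The rational function `Ψ_{m,n} = (X³ + aX + b) f_m f_n / (g_m g_n)`. -/
noncomputable def Psi {F : Type*} [Field F] (a b : F) (m n : ℕ) :
    RatFunc (AlgebraicClosure F) :=
  toRat F ((X ^ 3 + C a * X + C b) * (f a b m * f a b n)) / toRat F (g a b m * g a b n)

end EllDivPoly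

/-! The ratio `Φ_n / ΨSq_n` is the map x(P) ↦ x(nP). Over an algebraically closed field the roots of
`Φ_n - r ΨSq_n` are therefore the x-coordinates of the points P with nP = ±R, where x(R) = r. If R
is not 2-torsion they correspond to a coset of E[n], so there are #E[n] of them
(`card_roots_Φ_sub`). A pencil of coprime polynomials whose members almost all have N distinct roots
consists of p^k-th powers (`exists_eq_pow_of_card_roots`). Since b ≠ 0, the points over x = 0 are
not 2-torsion, so the count also holds at r = 0: every root of `Φ_n` has the same multiplicity p^k,
which is odd because p ≠ 2.

At these roots `ΨSq_n` has even order. If `Φ_{m,n}` is a square, parity forces `Φ_m` and `Φ_n` to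
have the same roots, whence #E[m] = #E[n]. On comparing degrees, n² = p^k #E[n], so m and n differ
by a power of p; a point of order p then excludes m ≠ n (`eq_of_card_torsion_eq`). For `Ψ_{m,n}` the
parity of the degree suffices.

The multiplication formula (`exists_eval_Φ_ΨSq_eq_mul_xRep`) rests on identities for elliptic
sequences. They match the formulas for the sum and product of x(Q + P) and x(Q - P). -/

namespace EllDivPoly

/-! ### Elliptic relations for sequences in a field. -/

section EllipticSequence

variable {L : Type*} [Field L] {W : ℤ → L} {b c i : L}

/-- The quotient `W(n+1)W(n-1)/W(n)²` of a sequence `W`. -/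
def seqRatio (W : ℤ → L) (n : ℤ) : L := W (n + 1) * W (n - 1) / W n ^ 2

/-- The elliptic relation between the terms of index `m + n`, `m - n`, `m` and `n`. -/
def SeqRel (W : ℤ → L) (m n : ℤ) : Prop :=
  W (m + n) * W (m - n) = W m ^ 2 * W n ^ 2 * (seqRatio W m - seqRatio W n)

lemma seqRatio_mul (hW : ∀ n, 0 < n → W n ≠ 0) {m : ℤ} (hm : 2 ≤ m) :
    seqRatio W m ^ 2 * (seqRatio W (m + 1) * seqRatio W (m - 1)) =
      W (m + 2) * W (m - 2) / W m ^ 2 := by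
  have h1 := hW m (by lia)
  have h2 := hW (m + 1) (by lia)
  have h3 := hW (m - 1) (by lia)
  simp only [seqRatio, add_sub_cancel_right, sub_add_cancel, add_assoc, sub_sub]
  norm_num
  field_simp

lemma seqRel_two_iff (hW : ∀ n, 0 < n → W n ≠ 0) (h1 : W 1 = 1) (h2 : W 2 = b) (h3 : W 3 = c)
    {m : ℤ} (hm : 2 ≤ m) : SeqRel W m 2 ↔
      seqRatio W m ^ 2 * (seqRatio W (m + 1) * seqRatio W (m - 1)) =
        b ^ 2 * seqRatio W m - c := by
  have hb : b ≠ 0 := h2 ▸ hW 2 (by lia)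
  have h0 := hW m (by lia)
  rw [seqRatio_mul hW hm, SeqRel, show seqRatio W 2 = c / b ^ 2 by simp [seqRatio, h1, h2, h3], h2]
  field_simp

lemma seqRel_one (h1 : W 1 = 1) {m : ℤ} (h0 : W 0 = 0) (hm : W m ≠ 0) : SeqRel W m 1 := by
  simp only [SeqRel, seqRatio, h1]
  norm_num [h0]
  field_simp

/-- The sum of the neighbours of a quotient, given their products. -/
lemma seqRatio_sum (hW : ∀ n, 0 < n → W n ≠ 0) (h0 : W 0 = 0) (h1 : W 1 = 1) (h2 : W 2 = b)
    (h3 : W 3 = c) (h4 : W 4 = (c * i - b ^ 4) * b) {N : ℤ}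
    (hS : ∀ m, 2 ≤ m → m ≤ N → SeqRel W m 2) {m : ℤ} (hm : 2 ≤ m) (hmN : m ≤ N) :
    seqRatio W m ^ 2 * (seqRatio W (m + 1) + seqRatio W (m - 1)) = i * seqRatio W m - b ^ 2 := by
  have hb : b ≠ 0 := h2 ▸ hW 2 (by lia)
  have hc : c ≠ 0 := h3 ▸ hW 3 (by lia)
  induction m, hm using Int.leInduction with
  | base =>
    simp only [seqRatio]
    norm_num [h0, h1, h2, h3, h4]
    field_simp
  | succ m hm ih =>
    have ih := ih (by lia)
    have s1 := (seqRel_two_iff hW h1 h2 h3 hm).1 (hS m hm (by lia))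
    have s2 := (seqRel_two_iff hW h1 h2 h3 (m := m + 1) (by lia)).1 (hS _ (by lia) hmN)
    rw [add_sub_cancel_right] at s2 ⊢
    have hr : seqRatio W m ≠ 0 := div_ne_zero (mul_ne_zero (hW _ (by lia)) (hW _ (by lia)))
      (pow_ne_zero _ (hW _ (by lia)))
    -- The expression (r_m² (r_{m+1} + r_{m-1}) + b²) / r_m is conserved: the product relations at m
    -- and m + 1 carry its value i along, and `W 4` fixes that value at m = 2.
    apply mul_left_cancel₀ hr
    linear_combination s2 + seqRatio W (m + 1) * ih - s1

/-- Multiplying the relations at (m + 1, n) and (m - 1, n) gives the same four terms as multiplying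
those at (m, n + 1) and (m, n - 1). What remains is a biquadratic identity between the quotients,
symmetric in m and n, that follows from the sums and products of their neighbours. -/
lemma SeqRel.step (hW : ∀ n, 0 < n → W n ≠ 0) {m n : ℤ} (hn : 2 ≤ n) (hmn : n + 2 ≤ m)
    (m1 : seqRatio W m ^ 2 * (seqRatio W (m + 1) + seqRatio W (m - 1)) = i * seqRatio W m - b ^ 2)
    (n1 : seqRatio W n ^ 2 * (seqRatio W (n + 1) + seqRatio W (n - 1)) = i * seqRatio W n - b ^ 2)
    (m2 : seqRatio W m ^ 2 * (seqRatio W (m + 1) * seqRatio W (m - 1)) = b ^ 2 * seqRatio W m - c)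
    (n2 : seqRatio W n ^ 2 * (seqRatio W (n + 1) * seqRatio W (n - 1)) = b ^ 2 * seqRatio W n - c)
    (r1 : SeqRel W m (n + 1)) (r2 : SeqRel W m (n - 1)) (r3 : SeqRel W (m - 1) n) :
    SeqRel W (m + 1) n := by
  have e1 : W (m + 1) * W (m - 1) = W m ^ 2 * seqRatio W m := by
    have := hW m (by lia)
    rw [seqRatio]; field_simp
  have e2 : W (n + 1) * W (n - 1) = W n ^ 2 * seqRatio W n := by
    have := hW n (by lia)
    rw [seqRatio]; field_simp
  have hne : W (m - 1 + n) * W (m - 1 - n) ≠ 0 :=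
    mul_ne_zero (hW _ (by lia)) (hW _ (by lia))
  unfold SeqRel at *
  have q : W (m + 1 + n) * W (m + 1 - n) * (W (m - 1 + n) * W (m - 1 - n)) =
      (W (m + (n + 1)) * W (m - (n + 1))) * (W (m + (n - 1)) * W (m - (n - 1))) := by
    rw [show m + 1 + n = m + (n + 1) by ring, show m + 1 - n = m - (n - 1) by ring,
      show m - 1 + n = m + (n - 1) by ring, show m - 1 - n = m - (n + 1) by ring]
    ring
  apply mul_right_cancel₀ hne
  rw [q, r1, r2, r3]
  have k1 : W m ^ 2 * W (n + 1) ^ 2 * (seqRatio W m - seqRatio W (n + 1)) *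
      (W m ^ 2 * W (n - 1) ^ 2 * (seqRatio W m - seqRatio W (n - 1))) =
      W m ^ 4 * (W (n + 1) * W (n - 1)) ^ 2 *
      ((seqRatio W m - seqRatio W (n + 1)) * (seqRatio W m - seqRatio W (n - 1))) := by ring
  have k2 : W (m + 1) ^ 2 * W n ^ 2 * (seqRatio W (m + 1) - seqRatio W n) *
      (W (m - 1) ^ 2 * W n ^ 2 * (seqRatio W (m - 1) - seqRatio W n)) =
      W n ^ 4 * (W (m + 1) * W (m - 1)) ^ 2 *
      ((seqRatio W (m + 1) - seqRatio W n) * (seqRatio W (m - 1) - seqRatio W n)) := by ring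
  rw [k1, k2, e1, e2]
  linear_combination W m ^ 4 * W n ^ 4 * (n2 - m2 - seqRatio W m * n1 + seqRatio W n * m1)

/-- A normalised sequence with nonzero terms that satisfies the duplication relations satisfies
all elliptic relations. -/
lemma seqRel_of_duplication (hW : ∀ n, 0 < n → W n ≠ 0) (h0 : W 0 = 0) (h1 : W 1 = 1)
    (h2 : W 2 = b) (h3 : W 3 = c) (h4 : W 4 = (c * i - b ^ 4) * b)
    (heven : ∀ m, W (2 * m) * b =
      W (m - 1) ^ 2 * W m * W (m + 2) - W (m - 2) * W m * W (m + 1) ^ 2)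
    (hodd : ∀ m, W (2 * m + 1) = W (m + 2) * W m ^ 3 - W (m - 1) * W (m + 1) ^ 3)
    {m n : ℤ} (hn : 1 ≤ n) (hmn : n < m) : SeqRel W m n := by
  -- Induction on m + n, then on m - n: `SeqRel.step` calls on one pair with the same sum and a
  -- difference smaller by 2, and otherwise on pairs with smaller sum.
  suffices H : ∀ s : ℕ, ∀ m n : ℤ, 1 ≤ n → n < m → m + n ≤ s → SeqRel W m n from
    H (m + n).toNat m n hn hmn (by lia)
  intro s
  induction s with
  | zero => intro m n _ _ _; lia
  | succ s ih =>
    suffices H : ∀ t : ℕ, ∀ m n : ℤ, 1 ≤ n → n < m → m + n = s + 1 → m - n ≤ t → SeqRel W m n by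
      intro m n h h' hs
      rcases (show m + n ≤ s ∨ m + n = s + 1 by push_cast at hs; lia) with hs | hs
      · exact ih m n h h' hs
      · exact H (m - n).toNat m n h h' hs (by lia)
    intro t
    induction t using Nat.strong_induction_on with
    | _ t iht =>
      intro m n hn hmn hs ht
      have hmW := hW m (by lia)
      have hnW := hW n (by lia)
      rcases eq_or_ne n 1 with rfl | hn1
      · exact seqRel_one h1 h0 hmW
      rcases (show m = n + 1 ∨ m = n + 2 ∨ n + 3 ≤ m by lia) with rfl | rfl | hlt
      · have := hodd n
        unfold SeqRel seqRatio
        rw [show n + 1 + n = 2 * n + 1 by ring, this, show n + 1 - n = 1 by ring, h1,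
          show n + 1 + 1 = n + 2 by ring, show n + 1 - 1 = n by ring]
        field_simp
      · have := heven (n + 1)
        unfold SeqRel seqRatio
        rw [show n + 2 + n = 2 * (n + 1) by ring, show n + 2 - n = 2 by ring, h2, this,
          show n + 1 - 1 = n by ring, show n + 1 - 2 = n - 1 by ring,
          show n + 2 + 1 = n + 1 + 2 by ring, show n + 2 - 1 = n + 1 by ring,
          show n + 1 + 1 = n + 2 by ring]
        field_simp
      · obtain ⟨m, rfl⟩ : ∃ k, m = k + 1 := ⟨m - 1, by ring⟩
        have hS : ∀ k, 2 ≤ k → k ≤ m → SeqRel W k 2 := by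
          intro k hk hkm
          rcases eq_or_ne k 2 with rfl | hk2
          · simp [SeqRel, h0]
          · exact ih k 2 (by lia) (by lia) (by lia)
        have hP : ∀ k, 2 ≤ k → k ≤ m → _ := fun k hk hkm =>
          (seqRel_two_iff hW h1 h2 h3 hk).1 (hS k hk hkm)
        exact SeqRel.step hW (by lia) (by lia)
          (seqRatio_sum hW h0 h1 h2 h3 h4 hS (by lia) le_rfl)
          (seqRatio_sum hW h0 h1 h2 h3 h4 hS (by lia) (by lia))
          (hP m (by lia) le_rfl) (hP n (by lia) (by lia))
          (iht (t - 2) (by lia) m (n + 1) (by lia) (by lia) (by lia) (by lia))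
          (ih m (n - 1) (by lia) (by lia) (by lia))
          (ih (m - 1) n (by lia) (by lia) (by lia))

end EllipticSequence

/-! ### Somos-4 relation and invariant over any commutative ring. -/

section NormEDS

/-- This specialisation shows that no term of positive index of the universal sequence vanishes. -/
lemma normEDS_two_three_two (n : ℕ) : normEDS (2 : ℤ) 3 2 n = n := by
  induction n using Nat.strong_induction_on with
  | _ n ih =>
    rcases lt_or_ge n 5 with h | h
    · interval_cases n
      · simp
      · simp
      · simp
      · simp
      · exact_mod_cast normEDS_four (2 : ℤ) 3 2
    · have key : ∀ k : ℤ, 0 ≤ k → k < n → normEDS (2 : ℤ) 3 2 k = k := by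
        intro k hk hkn
        lift k to ℕ using hk
        exact_mod_cast ih k (by exact_mod_cast hkn)
      rcases n.even_or_odd' with ⟨m, rfl | rfl⟩
      · have := normEDS_even (2 : ℤ) 3 2 m
        rw [key (m - 1) (by lia) (by push_cast; lia), key m (by lia) (by push_cast; lia),
          key (m + 2) (by lia) (by push_cast; lia), key (m - 2) (by lia) (by push_cast; lia),
          key (m + 1) (by lia) (by push_cast; lia)] at this
        push_cast
        have h2 : (2 : ℤ) ≠ 0 := two_ne_zero
        apply mul_right_cancel₀ h2
        linear_combination this
      · have := normEDS_odd (2 : ℤ) 3 2 m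
        rw [key (m - 1) (by lia) (by push_cast; lia), key m (by lia) (by push_cast; lia),
          key (m + 2) (by lia) (by push_cast; lia),
          key (m + 1) (by lia) (by push_cast; lia)] at this
        push_cast
        linear_combination this

lemma exists_ringHom_mvPolynomial {R : Type*} [CommRing R] (b c i : R) :
    ∃ φ : MvPolynomial (Fin 3) ℤ →+* R, φ (MvPolynomial.X 0) = b ∧ φ (MvPolynomial.X 1) = c ∧
      φ (MvPolynomial.X 2) = i :=
  ⟨(MvPolynomial.aeval ![b, c, i]).toRingHom, by simp, by simp, by simp⟩

/-- The Somos-4 relation and the invariant of a normalised elliptic sequence whose terms are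
nonzero. -/
lemma somos_and_invariant_of_ne_zero {R : Type*} [CommRing R] [IsDomain R] {b c i : R} {m : ℤ}
    (hm : 2 ≤ m) {W : ℤ → R} (hW : W = normEDS b c (c * i - b ^ 4)) (hW0 : ∀ n, 0 < n → W n ≠ 0) :
    W (m + 2) * W (m - 2) = b ^ 2 * (W (m + 1) * W (m - 1)) - c * W m ^ 2 ∧
    W (m + 2) * W (m - 1) ^ 2 + W (m + 1) ^ 2 * W (m - 2) + b ^ 2 * W m ^ 3 =
      i * (W (m + 1) * W m * W (m - 1)) := by
  obtain ⟨A, hA⟩ : ∃ A : R →+* FractionRing R, Function.Injective A :=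
    ⟨algebraMap _ _, IsFractionRing.injective ..⟩
  obtain ⟨w, hwW⟩ : ∃ w : ℤ → FractionRing R, ∀ n, w n = A (W n) := ⟨_, fun _ => rfl⟩
  have hw : ∀ n, 0 < n → w n ≠ 0 := fun n hn => hwW n ▸ (map_ne_zero_iff A hA).2 (hW0 n hn)
  have w0 : w 0 = 0 := by simp [hwW, hW]
  have w1 : w 1 = 1 := by simp [hwW, hW]
  have w2 : w 2 = A b := by simp [hwW, hW]
  have w3 : w 3 = A c := by simp [hwW, hW]
  have w4 : w 4 = (A c * A i - A b ^ 4) * A b := by simp [hwW, hW]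
  have hS : ∀ k, 2 ≤ k → k ≤ m → SeqRel w k 2 := by
    intro k hk _
    rcases eq_or_ne k 2 with rfl | hk2
    · simp [SeqRel, w0]
    · refine seqRel_of_duplication hw w0 w1 w2 w3 w4 ?_ ?_ (by lia) (by lia)
      · intro k
        simp only [hwW, ← map_mul, ← map_pow, ← map_sub, hW]
        exact congrArg A (normEDS_even ..)
      · intro k
        simp only [hwW, ← map_mul, ← map_pow, ← map_sub, hW]
        exact congrArg A (normEDS_odd ..)
  have s1 := (seqRel_two_iff hw w1 w2 w3 (m := m) (by lia)).1 (hS m (by lia) le_rfl)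
  have s2 := seqRatio_sum hw w0 w1 w2 w3 w4 hS (by lia) le_rfl
  rw [seqRatio_mul hw (by lia)] at s1
  simp only [seqRatio, add_sub_cancel_right, sub_add_cancel] at s1 s2
  rw [show m + 1 + 1 = m + 2 by ring, show m - 1 - 1 = m - 2 by ring] at s2
  have hw1 := hw m (by lia)
  have hw2 := hw (m + 1) (by lia)
  have hw3 := hw (m - 1) (by lia)
  field_simp at s1 s2
  constructor <;> apply hA <;> simp only [map_mul, map_sub, map_pow, map_add, ← hwW]
  · linear_combination s1
  · linear_combination s2

/-- The Somos-4 relation and the invariant of a normalised elliptic sequence. -/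
lemma normEDS_somos_and_invariant {R : Type*} [CommRing R] (b c i : R) {m : ℤ} (hm : 1 ≤ m)
    {W : ℤ → R} (hW : W = normEDS b c (c * i - b ^ 4)) :
    W (m + 2) * W (m - 2) = b ^ 2 * (W (m + 1) * W (m - 1)) - c * W m ^ 2 ∧
    W (m + 2) * W (m - 1) ^ 2 + W (m + 1) ^ 2 * W (m - 2) + b ^ 2 * W m ^ 3 =
      i * (W (m + 1) * W m * W (m - 1)) := by
  rcases hm.eq_or_lt with rfl | hm
  · subst hW
    norm_num
  -- Both identities are polynomial in b, c, i, so it suffices to treat indeterminates. Nonvanishing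
  -- is checked at b = 2, c = 3, i = 6, where c i - b⁴ = 2.
  have H := somos_and_invariant_of_ne_zero (R := MvPolynomial (Fin 3) ℤ) (b := .X 0) (c := .X 1)
    (i := .X 2) hm rfl fun n hn h => by
      lift n to ℕ using hn.le
      obtain ⟨φ, e0, e1, e2⟩ := exists_ringHom_mvPolynomial (2 : ℤ) 3 6
      have := congrArg φ h
      simp only [map_normEDS, map_sub, map_mul, map_pow, e0, e1, e2, map_zero] at this
      rw [show (3 : ℤ) * 6 - 2 ^ 4 = 2 by norm_num, normEDS_two_three_two] at this
      lia
  obtain ⟨φ, e0, e1, e2⟩ := exists_ringHom_mvPolynomial b c i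
  have H1 := congrArg φ H.1
  have H2 := congrArg φ H.2
  simp only [map_normEDS, map_sub, map_mul, map_pow, map_add, e0, e1, e2] at H1 H2
  rw [hW]
  exact ⟨H1, H2⟩

end NormEDS

/-! ### The multiplication formula on points. -/

section Points

open scoped Classical in
/-- The sum and product of the `x`-coordinates of `Q + P` and `Q - P`, projectively. -/
lemma exists_xRep_add_sub {K : Type*} [Field K] (h2 : (2 : K) ≠ 0) {a b x y : K}
    (h : (curve a b).toAffine.Nonsingular x y) (Q : (curve a b).toAffine.Point) :
    ∃ κ : K, κ ≠ 0 ∧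
      κ * ((Q + .some x y h).xRep 0 * (Q - .some x y h).xRep 0) =
        (Q.xRep 0 * x - a * Q.xRep 1) ^ 2 - 4 * b * Q.xRep 1 * (Q.xRep 0 + x * Q.xRep 1) ∧
      κ * ((Q + .some x y h).xRep 0 * (Q - .some x y h).xRep 1 +
          (Q + .some x y h).xRep 1 * (Q - .some x y h).xRep 0) =
        2 * ((x * Q.xRep 0 + a * Q.xRep 1) * (Q.xRep 0 + x * Q.xRep 1) + 2 * b * Q.xRep 1 ^ 2) ∧
      κ * ((Q + .some x y h).xRep 1 * (Q - .some x y h).xRep 1) =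
        (x * Q.xRep 1 - Q.xRep 0) ^ 2 := by
  have heq : y ^ 2 = x ^ 3 + a * x + b := by
    simpa [curve, WeierstrassCurve.Affine.equation_iff] using h.1
  set P : (curve a b).toAffine.Point := .some x y h with hP
  have hself : ∃ κ : K, κ ≠ 0 ∧ κ * (P + P).xRep 0 = (x * x - a) ^ 2 - 4 * b * (x + x) ∧
      κ * (P + P).xRep 1 = 2 * ((x * x + a) * (x + x) + 2 * b) := by
    by_cases hy : y = 0
    · have : P + P = 0 :=
        WeierstrassCurve.Affine.Point.add_self_of_Y_eq (by simp [curve, hy])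
      rw [this]
      have hx : 3 * x ^ 2 + a ≠ 0 := by
        have := ((WeierstrassCurve.Affine.nonsingular_iff ..).1 h).2
        simp [curve, hy] at this
        exact fun h => this h.symm
      subst hy
      -- Here 2P = 0 is represented by (1 : 0), so the scalar is the duplication numerator itself;
      -- on y = 0 it equals this square, nonzero by nonsingularity.
      refine ⟨(3 * x ^ 2 + a) ^ 2, pow_ne_zero _ hx, ?_, ?_⟩
      · simp
        linear_combination -8 * x * heq
      · rw [WeierstrassCurve.Affine.Point.xRep_zero]
        simp only [Matrix.cons_val_one, Matrix.cons_val_fin_one]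
        linear_combination 4 * heq
    · have hyn : y ≠ (curve a b).toAffine.negY x y := by
        simp [curve, WeierstrassCurve.Affine.negY]
        intro h
        exact hy ((mul_eq_zero.1 (show 2 * y = 0 by linear_combination h)).resolve_left h2)
      rw [hP, WeierstrassCurve.Affine.Point.add_self_of_Y_ne hyn]
      refine ⟨4 * y ^ 2, mul_ne_zero (by
        rw [show (4 : K) = 2 * 2 by norm_num]; exact mul_ne_zero h2 h2) (pow_ne_zero _ hy), ?_, ?_⟩
      · rw [WeierstrassCurve.Affine.Point.xRep_some, Matrix.cons_val_zero,
          WeierstrassCurve.Affine.slope_of_Y_ne rfl hyn]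
        simp only [curve, WeierstrassCurve.Affine.addX, WeierstrassCurve.Affine.negY]
        norm_num
        have hyy : y + y ≠ 0 := by rw [← two_mul]; exact mul_ne_zero h2 hy
        have hl := div_mul_cancel₀ (3 * x ^ 2 + a) hyy
        generalize (3 * x ^ 2 + a) / (y + y) = l at *
        linear_combination (l * (y + y) + 3 * x ^ 2 + a) * hl - 8 * x * heq
      · simp
        linear_combination 4 * heq
  by_cases hQP : Q = P
  · obtain ⟨κ, hκ, e1, e2⟩ := hself
    rw [hQP, sub_self]
    refine ⟨κ, hκ, ?_, ?_, ?_⟩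
    · simp [hP] at *
      linear_combination e1
    · simp [hP] at *
      linear_combination e2
    · simp [hP]
  by_cases hQP' : Q = -P
  · obtain ⟨κ, hκ, e1, e2⟩ := hself
    rw [hQP', neg_add_cancel, show -P - P = -(P + P) by abel]
    simp only [WeierstrassCurve.Affine.Point.xRep_neg]
    refine ⟨κ, hκ, ?_, ?_, ?_⟩
    · simp [hP] at *
      linear_combination e1
    · simp [hP] at *
      linear_combination e2
    · simp [hP]
  match Q with
  | 0 =>
    refine ⟨1, one_ne_zero, ?_, ?_, ?_⟩ <;> simp [hP]
    · ring
    · ring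
  | .some x' y' h' =>
    have hx : x' ≠ x := by
      intro hx
      rcases WeierstrassCurve.Affine.Point.X_eq_iff (h₁ := h') (h₂ := h) |>.1 hx with h | h
      · exact hQP h
      · exact hQP' h
    have heq' : y' ^ 2 = x' ^ 3 + a * x' + b := by
      simpa [curve, WeierstrassCurve.Affine.equation_iff] using h'.1
    rw [sub_eq_add_neg, hP, WeierstrassCurve.Affine.Point.neg_some,
      WeierstrassCurve.Affine.Point.add_of_X_ne hx, WeierstrassCurve.Affine.Point.add_of_X_ne hx]
    have hx' := sub_ne_zero.2 hx
    simp only [WeierstrassCurve.Affine.Point.xRep_some, Matrix.cons_val_zero,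
      Matrix.cons_val_one, Matrix.cons_val_fin_one, WeierstrassCurve.Affine.slope_of_X_ne hx]
    simp only [curve, WeierstrassCurve.Affine.addX, WeierstrassCurve.Affine.negY]
    refine ⟨(x' - x) ^ 2, pow_ne_zero _ hx', ?_, ?_, ?_⟩
    · field_simp
      linear_combination (heq' - heq) * (y' ^ 2 - y ^ 2 + x' ^ 3 + a * x' - x ^ 3 - a * x) -
        2 * (x + x') * (x' - x) ^ 2 * (heq + heq')
    · field_simp
      linear_combination 2 * heq + 2 * heq'
    · ring

/-- `preΨ` omits the factor ψ₂ at even indices; restoring it as 2y gives a normalised elliptic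
sequence, whose invariant is i = 6x² + 2a. -/
lemma eval_ΨSq_and_Φ {K : Type*} [Field K] {a b x y : K} (heq : y ^ 2 = x ^ 3 + a * x + b)
    {w : ℤ → K} (hw : w = normEDS (2 * y) (3 * x ^ 4 + 6 * a * x ^ 2 + 12 * b * x - a ^ 2)
      ((3 * x ^ 4 + 6 * a * x ^ 2 + 12 * b * x - a ^ 2) * (6 * x ^ 2 + 2 * a) - (2 * y) ^ 4))
    (n : ℤ) :
    ((curve a b).ΨSq n).eval x = w n ^ 2 ∧
      ((curve a b).Φ n).eval x = x * w n ^ 2 - w (n + 1) * w (n - 1) := by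
  have hD : ((curve a b).Ψ₂Sq).eval x = (2 * y) ^ 2 := by
    simp [WeierstrassCurve.Ψ₂Sq, curve, WeierstrassCurve.b₂, WeierstrassCurve.b₄,
      WeierstrassCurve.b₆]
    linear_combination -4 * heq
  have h3 : ((curve a b).Ψ₃).eval x = 3 * x ^ 4 + 6 * a * x ^ 2 + 12 * b * x - a ^ 2 := by
    simp [WeierstrassCurve.Ψ₃, curve, WeierstrassCurve.b₂, WeierstrassCurve.b₄,
      WeierstrassCurve.b₆, WeierstrassCurve.b₈]
    ring
  have h4 : ((curve a b).preΨ₄).eval x =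
      (3 * x ^ 4 + 6 * a * x ^ 2 + 12 * b * x - a ^ 2) * (6 * x ^ 2 + 2 * a) - (2 * y) ^ 4 := by
    simp [WeierstrassCurve.preΨ₄, curve, WeierstrassCurve.b₂, WeierstrassCurve.b₄,
      WeierstrassCurve.b₆, WeierstrassCurve.b₈]
    linear_combination 16 * (y ^ 2 + x ^ 3 + a * x + b) * heq
  have hpre : ∀ n, ((curve a b).preΨ n).eval x * (if Even n then 2 * y else 1) = w n := by
    intro n
    rw [hw, normEDS, WeierstrassCurve.preΨ, ← coe_evalRingHom, map_preNormEDS]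
    simp only [coe_evalRingHom, eval_pow, hD, h3, h4]
    ring_nf
  have hsq : ((curve a b).ΨSq n).eval x = w n ^ 2 := by
    rw [← hpre, WeierstrassCurve.ΨSq, eval_mul, eval_pow]
    split_ifs
    · rw [hD]; ring
    · simp
  refine ⟨hsq, ?_⟩
  rw [← hpre (n + 1), ← hpre (n - 1), WeierstrassCurve.Φ, eval_sub, eval_mul, hsq, eval_mul,
    eval_mul, eval_X]
  simp only [Int.even_add_one, Int.even_sub_one]
  split_ifs
  · simp
  · rw [hD]; ring

/-- The recursion of the division polynomials at a point that mirrors `exists_xRep_add_sub`. -/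
lemma eval_Φ_ΨSq_add_sub {K : Type*} [Field K] {a b x y : K} (heq : y ^ 2 = x ^ 3 + a * x + b)
    {n : ℤ} (hn : 1 ≤ n) {F G : ℤ → K} (hF : ∀ n, F n = ((curve a b).Φ n).eval x)
    (hG : ∀ n, G n = ((curve a b).ΨSq n).eval x) :
    F (n + 1) * F (n - 1) = (F n * x - a * G n) ^ 2 - 4 * b * G n * (F n + x * G n) ∧
    F (n + 1) * G (n - 1) + G (n + 1) * F (n - 1) =
      2 * ((x * F n + a * G n) * (F n + x * G n) + 2 * b * G n ^ 2) ∧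
    G (n + 1) * G (n - 1) = (x * G n - F n) ^ 2 := by
  obtain ⟨w, hw⟩ : ∃ w : ℤ → K, w = normEDS (2 * y)
    (3 * x ^ 4 + 6 * a * x ^ 2 + 12 * b * x - a ^ 2)
    ((3 * x ^ 4 + 6 * a * x ^ 2 + 12 * b * x - a ^ 2) * (6 * x ^ 2 + 2 * a) - (2 * y) ^ 4) :=
    ⟨_, rfl⟩
  obtain ⟨h1, h2⟩ := normEDS_somos_and_invariant _ _ _ hn hw
  simp only [hF, hG, (eval_ΨSq_and_Φ heq hw _).1, (eval_ΨSq_and_Φ heq hw _).2]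
  rw [show n + 1 + 1 = n + 2 by ring, show n + 1 - 1 = n by ring, show n - 1 + 1 = n by ring,
    show n - 1 - 1 = n - 2 by ring]
  have hy : (2 * y) ^ 2 = 4 * (x ^ 3 + a * x + b) := by linear_combination 4 * heq
  rw [hy] at h1 h2
  refine ⟨?_, ?_, ?_⟩
  · linear_combination w n ^ 2 * h1 - x * w n * h2
  · linear_combination -w n * h2
  · ring

open scoped Classical in
/-- The multiplication formula: `(Φ_n(x) : ΨSq_n(x))` is the `x`-coordinate of `nP`. -/
theorem exists_eval_Φ_ΨSq_eq_mul_xRep {K : Type*} [Field K] (h2 : (2 : K) ≠ 0) {a b x y : K}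
    (h : (curve a b).toAffine.Nonsingular x y) (n : ℕ) :
    ∃ κ : K, κ ≠ 0 ∧
      ((curve a b).Φ n).eval x =
        κ * (n • (.some x y h : (curve a b).toAffine.Point)).xRep 0 ∧
      ((curve a b).ΨSq n).eval x =
        κ * (n • (.some x y h : (curve a b).toAffine.Point)).xRep 1 := by
  have heq : y ^ 2 = x ^ 3 + a * x + b := by
    simpa [curve, WeierstrassCurve.Affine.equation_iff] using h.1
  induction n using Nat.twoStepInduction with
  | zero => exact ⟨1, one_ne_zero, by simp, by simp⟩
  | one => exact ⟨1, one_ne_zero, by simp, by simp⟩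
  | more n ih0 ih1 =>
    set P : (curve a b).toAffine.Point := .some x y h with hP
    obtain ⟨r, hr, r1, r2⟩ := ih0
    obtain ⟨s, hs, s1, s2⟩ := ih1
    obtain ⟨k, hk, k1, k2, k3⟩ := exists_xRep_add_sub h2 h ((n + 1) • P)
    obtain ⟨e1, e2, e3⟩ := eval_Φ_ΨSq_add_sub heq (n := n + 1) (by lia)
      (F := fun n => ((curve a b).Φ n).eval x) (G := fun n => ((curve a b).ΨSq n).eval x)
      (fun _ => rfl) (fun _ => rfl)
    rw [← hP, show (n + 1) • P + P = (n + 2) • P by rw [← succ_nsmul],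
      show (n + 1) • P - P = n • P by rw [succ_nsmul]; abel] at k1 k2 k3
    push_cast at s1 s2 ⊢
    simp only [add_sub_cancel_right, show (n : ℤ) + 1 + 1 = n + 2 by ring, s1, s2, r1, r2]
      at e1 e2 e3
    refine ⟨s ^ 2 * k / r, div_ne_zero (mul_ne_zero (pow_ne_zero _ hs) hk) hr, ?_⟩
    revert e1 e2 e3 k1 k2 k3
    generalize ((curve a b).Φ (n + 2)).eval x = f
    generalize ((curve a b).ΨSq (n + 2)).eval x = g
    generalize ((n + 2) • P).xRep = X
    generalize ((n + 1) • P).xRep = Z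
    intro k1 k2 k3 e1 e2 e3
    have c1 : f * (r * (n • P).xRep 0) = s ^ 2 * (k * (X 0 * (n • P).xRep 0)) := by
      rw [k1]; linear_combination e1
    have c2 : f * (r * (n • P).xRep 1) + g * (r * (n • P).xRep 0) =
        s ^ 2 * (k * (X 0 * (n • P).xRep 1 + X 1 * (n • P).xRep 0)) := by
      rw [k2]; linear_combination e2
    have c3 : g * (r * (n • P).xRep 1) = s ^ 2 * (k * (X 1 * (n • P).xRep 1)) := by
      rw [k3]; linear_combination e3
    clear k1 k2 k3 e1 e2 e3
    generalize n • P = Q at *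
    -- The product and mixed equations determine the values at n + 2 when nP = O; otherwise the
    -- mixed equation and the last one do.
    match Q with
    | 0 =>
      simp at c1 c2
      constructor
      · field_simp; linear_combination c1
      · field_simp; linear_combination c2
    | .some x' y' h' =>
      simp at c2 c3
      constructor
      · field_simp; linear_combination c2 - x' * c3
      · field_simp; linear_combination c3

end Points

/-! ### Pencils of polynomials in characteristic p. -/

section Roots

variable {K : Type*} [Field K]

lemma natDegree_sub_C_mul {f g : K[X]} (hdeg : g.natDegree < f.natDegree) (r : K) :
    (f - C r * g).natDegree = f.natDegree :=
  natDegree_sub_eq_left_of_natDegree_lt ((natDegree_C_mul_le r g).trans_lt hdeg)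

variable [IsAlgClosed K]

open scoped Classical in
/-- Coprime polynomials with nonzero Wronskian have only finitely many inseparable members in
their pencil. -/
lemma exists_finite_card_roots_eq_natDegree {f g : K[X]} (hco : IsCoprime f g)
    (hdeg : g.natDegree < f.natDegree) (hw : derivative f * g - f * derivative g ≠ 0) :
    ∃ S : Set K, S.Finite ∧ ∀ r ∉ S, (f - C r * g).roots.toFinset.card = f.natDegree := by
  classical
  refine ⟨(fun s => f.eval s / g.eval s) '' {s | s ∈ (derivative f * g - f * derivative g).roots},
    (Multiset.finite_toSet _).image _, fun r hr => ?_⟩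
  have hsep : (f - C r * g).Separable := by
    rw [Polynomial.Separable, isCoprime_iff_aeval_ne_zero_of_isAlgClosed K K]
    -- A multiple root s of f - r g is a zero of the Wronskian with r = f(s)/g(s), so only finitely
    -- many r occur.
    by_contra! h
    obtain ⟨s, h1, h2⟩ := h
    simp at h1 h2
    have hg : g.eval s ≠ 0 := by
      intro hg
      have := (isCoprime_iff_aeval_ne_zero_of_isAlgClosed K K f g).1 hco s
      simp [hg] at this
      simp [hg, this] at h1
    refine hr ⟨s, ?_, ?_⟩
    · rw [Set.mem_ofPred_eq, mem_roots hw]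
      simp
      linear_combination eval s g * h2 - eval s (derivative g) * h1
    · field_simp
      linear_combination h1
  rw [Multiset.toFinset_card_of_nodup (nodup_roots hsep), IsAlgClosed.card_roots_eq_natDegree,
    natDegree_sub_C_mul hdeg]

lemma exists_eq_pow_of_derivative_eq_zero (p : ℕ) [Fact p.Prime] [CharP K p] {f : K[X]}
    (hf : derivative f = 0) : ∃ h, f = h ^ p := by
  refine ⟨(contract p f).map (frobeniusEquiv K p).symm, ?_⟩
  rw [← map_frobenius_expand, map_expand, map_map]
  have : (frobenius K p).comp ((frobeniusEquiv K p).symm : K →+* K) = RingHom.id K := by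
    ext x
    simp
  rw [this, map_id, expand_contract p hf (Fact.out : p.Prime).ne_zero]

open scoped Classical in
/-- If almost all members of a pencil have `N` roots then the pencil consists of `p ^ k`-th powers
of polynomials of degree `N`. -/
theorem exists_eq_pow_of_card_roots (p : ℕ) [Fact p.Prime] [CharP K p] {N : ℕ} {f g : K[X]}
    (hco : IsCoprime f g) (hdeg : g.natDegree < f.natDegree) {S : Set K} (hS : S.Finite)
    (hN : ∀ r ∉ S, (f - C r * g).roots.toFinset.card = N) :
    ∃ k, ∃ h : K[X], f = h ^ p ^ k ∧ h.natDegree = N := by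
  classical
  induction hd : f.natDegree using Nat.strong_induction_on generalizing f g S with
  | _ d ih =>
    have hp := (Fact.out : p.Prime)
    have hf0 : f ≠ 0 := ne_zero_of_natDegree_gt hdeg
    by_cases hw : derivative f * g - f * derivative g = 0
    · have hf' : derivative f = 0 := by
        by_contra hf'
        have hdvd : f ∣ derivative f :=
          hco.dvd_of_dvd_mul_right ⟨derivative g, sub_eq_zero.1 hw⟩
        exact absurd (natDegree_le_of_dvd hdvd hf')
          (not_le.2 (natDegree_derivative_lt (by lia)))
      have hg' : derivative g = 0 := by simpa [hf', hf0] using hw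
      obtain ⟨f, rfl⟩ := exists_eq_pow_of_derivative_eq_zero p hf'
      obtain ⟨g, rfl⟩ := exists_eq_pow_of_derivative_eq_zero p hg'
      rw [natDegree_pow] at hd
      rw [natDegree_pow, natDegree_pow] at hdeg
      have hdeg' := Nat.lt_of_mul_lt_mul_left hdeg
      have hlt : f.natDegree < d := by
        have := hp.two_le
        nlinarith
      -- As f^p - r^p g^p = (f - r g)^p, the p-th roots form a pencil with the same root counts, its
      -- exceptional set being pulled back along Frobenius.
      obtain ⟨k, h, rfl, hh⟩ := ih f.natDegree hlt (f := f) (g := g)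
        (S := (frobenius K p) ⁻¹' S) ((IsCoprime.pow_iff hp.pos hp.pos).1 hco) hdeg'
        (hS.preimage (frobenius_inj K p).injOn) (fun r hr => by
          rw [← hN _ hr, frobenius_def, C_pow, ← mul_pow, ← sub_pow_char, roots_pow,
            Multiset.toFinset_nsmul _ _ hp.ne_zero]) rfl
      exact ⟨k + 1, h, by rw [pow_succ, pow_mul], hh⟩
    · obtain ⟨T, hT, hTN⟩ := exists_finite_card_roots_eq_natDegree hco hdeg hw
      obtain ⟨r, hr⟩ := (hS.union hT).infinite_compl.nonempty
      simp only [Set.mem_compl_iff, Set.mem_union, not_or] at hr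
      exact ⟨0, f, by simp, by rw [← hTN r hr.2, hN r hr.1]⟩

end Roots

/-! ### Fibres of multiplication by n. -/

section Fibres

variable {K : Type*} [Field K] {a b : K}

lemma two_ne_zero_of_isElliptic (hE : (curve a b).IsElliptic) : (2 : K) ≠ 0 := by
  intro h
  apply hE.isUnit.ne_zero
  simp [curve, WeierstrassCurve.Δ, WeierstrassCurve.b₂, WeierstrassCurve.b₄,
      WeierstrassCurve.b₆, WeierstrassCurve.b₈]
  linear_combination (-32 * a ^ 3 - 216 * b ^ 2) * h

lemma nonsingular_of_isElliptic (hE : (curve a b).IsElliptic) {x y : K}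
    (h : y ^ 2 = x ^ 3 + a * x + b) : (curve a b).toAffine.Nonsingular x y := by
  rw [← WeierstrassCurve.Affine.equation_iff_nonsingular, WeierstrassCurve.Affine.equation_iff]
  simpa [curve] using h

lemma sq_eq_of_nonsingular {x y : K} (h : (curve a b).toAffine.Nonsingular x y) :
    y ^ 2 = x ^ 3 + a * x + b := by
  simpa [curve, WeierstrassCurve.Affine.equation_iff] using h.1

lemma exists_nonsingular [IsAlgClosed K] (hE : (curve a b).IsElliptic) (x : K) :
    ∃ y, (curve a b).toAffine.Nonsingular x y := by
  obtain ⟨y, hy⟩ := IsAlgClosed.exists_pow_nat_eq (x ^ 3 + a * x + b) two_pos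
  exact ⟨y, nonsingular_of_isElliptic hE hy⟩

lemma natDegree_ΨSq_lt {n : ℕ} (hn : 0 < n) :
    ((curve a b).ΨSq n).natDegree < ((curve a b).Φ n).natDegree := by
  have := (curve a b).natDegree_ΨSq_le n
  rw [WeierstrassCurve.natDegree_Φ]
  simp only [Int.natAbs_natCast] at *
  have : 0 < n ^ 2 := by positivity
  lia

/-- At a common zero the projective x-coordinate of nP would be (0 : 0). -/
lemma isCoprime_Φ_ΨSq [IsAlgClosed K] (hE : (curve a b).IsElliptic) (n : ℕ) :
    IsCoprime ((curve a b).Φ n) ((curve a b).ΨSq n) := by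
  classical
  rw [isCoprime_iff_aeval_ne_zero_of_isAlgClosed K K]
  intro x
  obtain ⟨y, h⟩ := exists_nonsingular hE x
  obtain ⟨κ, hκ, h1, h2⟩ := exists_eval_Φ_ΨSq_eq_mul_xRep (two_ne_zero_of_isElliptic hE) h n
  by_contra! hc
  simp only [coe_aeval_eq_eval, h1, h2, mul_eq_zero, hκ, false_or] at hc
  apply WeierstrassCurve.Affine.Point.xRep_ne_zero
    (n • (.some x y h : (curve a b).toAffine.Point))
  ext i
  fin_cases i
  · exact hc.1
  · exact hc.2

lemma ΨSq_ne_zero [IsAlgClosed K] (hE : (curve a b).IsElliptic) {n : ℕ} (hn : 0 < n) :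
    (curve a b).ΨSq n ≠ 0 := by
  intro h
  have hco := isCoprime_Φ_ΨSq hE n
  have hdeg := natDegree_ΨSq_lt (a := a) (b := b) hn
  rw [h, isCoprime_zero_right] at hco
  have := natDegree_eq_zero_of_isUnit hco
  lia

open scoped Classical in
/-- The roots of `Φ_n - r ΨSq_n` are the `x`-coordinates of the points `P` with `nP = ±R`, where
`R` has `x`-coordinate `r`. -/
lemma eval_Φ_sub_eq_zero_iff (hE : (curve a b).IsElliptic) (n : ℕ) {x y r t : K}
    (h : (curve a b).toAffine.Nonsingular x y) (h' : (curve a b).toAffine.Nonsingular r t) :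
    ((curve a b).Φ n - C r * (curve a b).ΨSq n).eval x = 0 ↔
      n • (.some x y h : (curve a b).toAffine.Point) = .some r t h' ∨
      n • (.some x y h : (curve a b).toAffine.Point) = -.some r t h' := by
  obtain ⟨κ, hκ, h1, h2⟩ := exists_eval_Φ_ΨSq_eq_mul_xRep (two_ne_zero_of_isElliptic hE) h n
  rw [eval_sub, eval_mul, eval_C, h1, h2]
  generalize n • (.some x y h : (curve a b).toAffine.Point) = Q
  match Q with
  | 0 =>
    simp only [WeierstrassCurve.Affine.Point.xRep_zero, Matrix.cons_val_zero,
      Matrix.cons_val_one, Matrix.cons_val_fin_one]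
    simp [hκ, eq_comm (a := (0 : (curve a b).toAffine.Point))]
  | .some x' y' h'' =>
    rw [← WeierstrassCurve.Affine.Point.X_eq_iff]
    simp only [WeierstrassCurve.Affine.Point.xRep_some, Matrix.cons_val_zero,
      Matrix.cons_val_one, Matrix.cons_val_fin_one]
    rw [show κ * x' - r * (κ * 1) = κ * (x' - r) by ring, mul_eq_zero, sub_eq_zero]
    simp [hκ]

lemma Φ_sub_ne_zero {n : ℕ} (hn : 0 < n) (r : K) :
    (curve a b).Φ n - C r * (curve a b).ΨSq n ≠ 0 := by
  have hdeg := natDegree_ΨSq_lt (a := a) (b := b) hn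
  apply ne_zero_of_natDegree_gt (n := 0)
  rw [natDegree_sub_C_mul hdeg]
  lia

variable [IsAlgClosed K]

open scoped Classical in
lemma nsmul_surjective (hE : (curve a b).IsElliptic) {n : ℕ} (hn : 0 < n)
    (R : (curve a b).toAffine.Point) : ∃ P, n • P = R := by
  match R with
  | 0 => exact ⟨0, smul_zero _⟩
  | .some r t h' =>
    have hdeg := natDegree_ΨSq_lt (a := a) (b := b) hn
    obtain ⟨x, hx⟩ := IsAlgClosed.exists_root ((curve a b).Φ n - C r * (curve a b).ΨSq n) (by
      apply (natDegree_pos_iff_degree_pos.1 _).ne'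
      rw [natDegree_sub_C_mul hdeg]
      lia)
    obtain ⟨y, h⟩ := exists_nonsingular hE x
    rcases (eval_Φ_sub_eq_zero_iff hE n h h').1 hx with e | e
    · exact ⟨_, e⟩
    · exact ⟨-.some x y h, by rw [smul_neg, e, neg_neg]⟩

open scoped Classical in
-- The points with nP = R form a coset of E[n]. The x-coordinate is injective on it because R ≠ -R,
-- and it reaches every root after replacing P by -P if necessary.
lemma card_roots_Φ_sub (hE : (curve a b).IsElliptic) {n : ℕ} (hn : 0 < n) {r : K}
    (hr : r ^ 3 + a * r + b ≠ 0) :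
    ((curve a b).Φ n - C r * (curve a b).ΨSq n).roots.toFinset.card =
      Nat.card {P : (curve a b).toAffine.Point // n • P = 0} := by
  obtain ⟨t, h'⟩ := exists_nonsingular hE r
  have ht : t ≠ 0 := by
    rintro rfl
    exact hr (by simpa using (sq_eq_of_nonsingular h').symm)
  set R : (curve a b).toAffine.Point := .some r t h' with hR
  have hRR : R ≠ -R := by
    rw [hR, WeierstrassCurve.Affine.Point.neg_some]
    intro h
    rw [WeierstrassCurve.Affine.Point.some.injEq] at h
    have h := h.2
    simp [WeierstrassCurve.Affine.negY, curve] at h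
    exact ht ((mul_eq_zero.1 (show 2 * t = 0 by linear_combination h)).resolve_left
      (two_ne_zero_of_isElliptic hE))
  obtain ⟨P₀, hP₀⟩ := nsmul_surjective hE hn R
  have e : {P : (curve a b).toAffine.Point // n • P = 0} ≃
      {P : (curve a b).toAffine.Point // n • P = R} :=
    (Equiv.addRight P₀).subtypeEquiv fun P => by simp [hP₀]
  rw [Nat.card_congr e, ← Fintype.card_coe, ← Nat.card_eq_fintype_card]
  symm
  have hmem : ∀ {x}, x ∈ ((curve a b).Φ n - C r * (curve a b).ΨSq n).roots ↔
      ((curve a b).Φ n - C r * (curve a b).ΨSq n).eval x = 0 := by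
    intro x
    rw [mem_roots (Φ_sub_ne_zero hn r), IsRoot]
  have hx : ∀ P : (curve a b).toAffine.Point, n • P = R →
      P.xRep 0 ∈ ((curve a b).Φ n - C r * (curve a b).ΨSq n).roots := by
    intro P hP
    match P with
    | 0 => simp [hR, eq_comm (a := (0 : (curve a b).toAffine.Point))] at hP
    | .some x y h => exact hmem.2 ((eval_Φ_sub_eq_zero_iff hE n h h').2 (.inl hP))
  refine Nat.card_congr (Equiv.ofBijective
    (fun P => ⟨P.1.xRep 0, by simpa using hx P.1 P.2⟩) ⟨?_, ?_⟩)
  · rintro ⟨P, hP⟩ ⟨Q, hQ⟩ h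
    simp only [Subtype.mk.injEq] at h ⊢
    match P, Q with
    | 0, _ => simp [hR, eq_comm (a := (0 : (curve a b).toAffine.Point))] at hP
    | .some .., 0 => simp [hR, eq_comm (a := (0 : (curve a b).toAffine.Point))] at hQ
    | .some x y h1, .some x' y' h2 =>
      rcases WeierstrassCurve.Affine.Point.X_eq_iff (h₁ := h1) (h₂ := h2) |>.1 h with e | e
      · exact e
      · rw [e, smul_neg, hQ] at hP
        exact absurd hP.symm hRR
  · rintro ⟨x, hx⟩
    obtain ⟨y, h⟩ := exists_nonsingular hE x
    rcases (eval_Φ_sub_eq_zero_iff hE n h h').1 (hmem.1 (by simpa using hx)) with e | e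
    · exact ⟨⟨_, e⟩, rfl⟩
    · exact ⟨⟨-.some x y h, by rw [smul_neg, e, neg_neg]⟩, by simp⟩

end Fibres

/-! ### Multiplicities of zeros and the size of the torsion. -/

section Multiplicities

variable {K : Type*} [Field K] [IsAlgClosed K] {a b : K}

open scoped Classical in
lemma card_roots_Φ (hE : (curve a b).IsElliptic) (hb : b ≠ 0) {n : ℕ} (hn : 0 < n) :
    ((curve a b).Φ n).roots.toFinset.card =
      Nat.card {P : (curve a b).toAffine.Point // n • P = 0} := by
  rw [← card_roots_Φ_sub hE hn (r := 0) (by simpa using hb)]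
  simp

open scoped Classical in
/-- `Φ_n` is a power of a separable polynomial whose degree is the number of `n`-torsion points. -/
lemma exists_Φ_eq_pow (p : ℕ) [Fact p.Prime] [CharP K p] (hE : (curve a b).IsElliptic)
    (hb : b ≠ 0) {n : ℕ} (hn : 0 < n) :
    ∃ k, ∃ h : K[X], (curve a b).Φ n = h ^ p ^ k ∧ h.roots.Nodup ∧
      h.natDegree = Nat.card {P : (curve a b).toAffine.Point // n • P = 0} := by
  have hfin : {r : K | r ^ 3 + a * r + b = 0}.Finite := by
    have h0 : (X ^ 3 + C a * X + C b : K[X]) ≠ 0 := by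
      intro h
      have := congrArg (coeff · 0) h
      simp [hb] at this
    refine ((X ^ 3 + C a * X + C b : K[X]).roots.finite_toSet).subset fun r hr => ?_
    simpa [mem_roots h0] using hr
  obtain ⟨k, h, hk, hN⟩ := exists_eq_pow_of_card_roots p (isCoprime_Φ_ΨSq hE n)
    (natDegree_ΨSq_lt hn) hfin (fun r hr => card_roots_Φ_sub hE hn hr)
  refine ⟨k, h, hk, ?_, hN⟩
  -- The member r = 0 also has `h.natDegree` distinct roots, so h has no repeated root.
  have hc := card_roots_Φ hE hb hn
  rw [hk, roots_pow, Multiset.toFinset_nsmul _ _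
    (pow_ne_zero _ (Fact.out : p.Prime).ne_zero), ← hN,
    ← IsAlgClosed.card_roots_eq_natDegree] at hc
  exact Multiset.toFinset_card_eq_card_iff_nodup.1 hc

lemma odd_rootMultiplicity_Φ (p : ℕ) [Fact p.Prime] [CharP K p] (hE : (curve a b).IsElliptic)
    (hb : b ≠ 0) {n : ℕ} (hn : 0 < n) {s : K} (hs : ((curve a b).Φ n).eval s = 0) :
    Odd (((curve a b).Φ n).rootMultiplicity s) := by
  classical
  obtain ⟨k, h, hk, hnd, -⟩ := exists_Φ_eq_pow p hE hb hn
  have h0 := (curve a b).Φ_ne_zero n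
  have hodd : Odd p := (Fact.out : p.Prime).odd_of_ne_two (by
    rintro rfl
    exact two_ne_zero_of_isElliptic hE (CharP.cast_eq_zero K 2))
  have hmem : s ∈ ((curve a b).Φ n).roots := (mem_roots h0).2 hs
  rw [← count_roots]
  rw [hk, roots_pow] at hmem ⊢
  rw [Multiset.count_nsmul, Multiset.count_eq_one_of_mem hnd (Multiset.mem_of_mem_nsmul hmem),
    mul_one]
  exact hodd.pow

open scoped Classical in
-- If s = x(P) with P 2-torsion, then nP is 2-torsion too; but nP = ±(0, t) with t² = b ≠ 0.
lemma eval_Ψ₂Sq_ne_zero_of_eval_Φ (hE : (curve a b).IsElliptic) (hb : b ≠ 0) {n : ℕ}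
    {s : K} (hs : ((curve a b).Φ n).eval s = 0) : (curve a b).Ψ₂Sq.eval s ≠ 0 := by
  have h2 := two_ne_zero_of_isElliptic hE
  obtain ⟨y, h⟩ := exists_nonsingular hE s
  obtain ⟨t, h'⟩ := exists_nonsingular hE 0
  have ht : t ≠ 0 := by
    rintro rfl
    exact hb (by simpa using (sq_eq_of_nonsingular h').symm)
  have heq := sq_eq_of_nonsingular h
  intro hD
  simp [WeierstrassCurve.Ψ₂Sq, curve, WeierstrassCurve.b₂, WeierstrassCurve.b₄,
      WeierstrassCurve.b₆] at hD
  have hy : y = 0 := by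
    have : (2 * y) ^ 2 = 0 := by linear_combination 4 * heq + hD
    exact (mul_eq_zero.1 (pow_eq_zero_iff two_ne_zero |>.1 this)).resolve_left h2
  subst hy
  have hPP : (.some s 0 h + .some s 0 h : (curve a b).toAffine.Point) = 0 :=
    WeierstrassCurve.Affine.Point.add_self_of_Y_eq (by simp [curve])
  have hQQ : (.some 0 t h' + .some 0 t h' : (curve a b).toAffine.Point) ≠ 0 := by
    rw [WeierstrassCurve.Affine.Point.add_self_of_Y_ne]
    · exact WeierstrassCurve.Affine.Point.some_ne_zero _
    · simp [curve, WeierstrassCurve.Affine.negY]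
      intro h
      exact ht ((mul_eq_zero.1 (show 2 * t = 0 by linear_combination h)).resolve_left h2)
  rcases (eval_Φ_sub_eq_zero_iff hE n h h').1 (by simpa using hs) with e | e
  · exact hQQ (by rw [← e, ← smul_add, hPP, smul_zero])
  · rw [← neg_eq_iff_eq_neg] at e
    exact hQQ (by rw [← e, ← neg_add, ← smul_add, hPP, smul_zero, neg_zero])

lemma even_rootMultiplicity_ΨSq (hE : (curve a b).IsElliptic) {n : ℕ} (hn : 0 < n) {s : K}
    (hs : (curve a b).Ψ₂Sq.eval s ≠ 0) : Even (((curve a b).ΨSq n).rootMultiplicity s) := by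
  classical
  have h0 := ΨSq_ne_zero hE hn
  have hs' : (curve a b).Ψ₂Sq.rootMultiplicity s = 0 := rootMultiplicity_eq_zero hs
  rw [WeierstrassCurve.ΨSq] at h0 ⊢
  rw [rootMultiplicity_mul h0, ← count_roots, roots_pow, Multiset.count_nsmul]
  split_ifs
  · simp [hs']
  · rw [rootMultiplicity_eq_zero (p := 1) (by simp)]
    simp

/-- If the product of two ratios `Φ_n / ΨSq_n` is a square, then they have the same zeros. -/
lemma eval_Φ_eq_zero_of_sq (p : ℕ) [Fact p.Prime] [CharP K p] (hE : (curve a b).IsElliptic)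
    (hb : b ≠ 0) {m n : ℕ} (hm : 0 < m) (hn : 0 < n) {A B : K[X]} (hB : B ≠ 0)
    (h : (curve a b).Φ m * (curve a b).Φ n * B ^ 2 = (curve a b).ΨSq m * (curve a b).ΨSq n * A ^ 2)
    {s : K} (hs : ((curve a b).Φ m).eval s = 0) : ((curve a b).Φ n).eval s = 0 := by
  classical
  by_contra hns
  have f1 := (curve a b).Φ_ne_zero m
  have f2 := (curve a b).Φ_ne_zero n
  have hl := mul_ne_zero (mul_ne_zero f1 f2) (pow_ne_zero 2 hB)
  have hr := h ▸ hl
  have hD := eval_Ψ₂Sq_ne_zero_of_eval_Φ hE hb hs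
  have := congrArg (rootMultiplicity s) h
  rw [rootMultiplicity_mul hl, rootMultiplicity_mul (left_ne_zero_of_mul hl),
    rootMultiplicity_mul hr, rootMultiplicity_mul (left_ne_zero_of_mul hr),
    rootMultiplicity_eq_zero (p := (curve a b).Φ n) hns] at this
  simp only [← count_roots, roots_pow, Multiset.count_nsmul] at this
  simp only [count_roots] at this
  have o := odd_rootMultiplicity_Φ p hE hb hm hs
  have e1 := even_rootMultiplicity_ΨSq hE hm hD
  have e2 := even_rootMultiplicity_ΨSq hE hn hD
  -- The order of the left side at s is odd, that of the right side even.
  grind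

open scoped Classical in
lemma card_torsion_mul_pow (p : ℕ) [Fact p.Prime] [CharP K p] (hE : (curve a b).IsElliptic)
    (hb : b ≠ 0) {n : ℕ} (hn : 0 < n) :
    ∃ k, n ^ 2 = p ^ k * Nat.card {P : (curve a b).toAffine.Point // n • P = 0} := by
  obtain ⟨k, h, hk, -, hN⟩ := exists_Φ_eq_pow p hE hb hn
  refine ⟨k, ?_⟩
  have := congrArg natDegree hk
  rw [WeierstrassCurve.natDegree_Φ, natDegree_pow, hN] at this
  simpa using this

open scoped Classical in
/-- On a curve with a point of order `p`, the number of `n`-torsion points determines `n`. -/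
lemma eq_of_card_torsion_eq (p : ℕ) [Fact p.Prime] [CharP K p] (hE : (curve a b).IsElliptic)
    (hb : b ≠ 0) {T : (curve a b).toAffine.Point} (hT : T ≠ 0) (hpT : p • T = 0)
    {m n : ℕ} (hm : 0 < m) (hn : 0 < n)
    (h : Nat.card {P : (curve a b).toAffine.Point // m • P = 0} =
      Nat.card {P : (curve a b).toAffine.Point // n • P = 0}) : m = n := by
  have hp : p.Prime := Fact.out
  obtain ⟨k, hk⟩ := card_torsion_mul_pow p hE hb hm
  obtain ⟨l, hl⟩ := card_torsion_mul_pow p hE hb hn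
  wlog hkl : k ≤ l generalizing m n k l
  · exact (this hn hm h.symm l hl k hk (by lia)).symm
  obtain ⟨j, rfl⟩ := Nat.exists_eq_add_of_le hkl
  -- Equal torsion counts make n²/m² a power of p, so n = m t with p ∣ t unless t = 1.
  have hnm : n ^ 2 = m ^ 2 * p ^ j := by rw [hl, hk, h]; ring
  obtain ⟨t, rfl⟩ : m ∣ n := (Nat.pow_dvd_pow_iff two_ne_zero).1 ⟨_, hnm⟩
  have ht : t ^ 2 = p ^ j := Nat.eq_of_mul_eq_mul_left (pow_pos hm 2) (by rw [← hnm]; ring)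
  by_contra hne
  have hj : j ≠ 0 := by
    rintro rfl
    exact hne (by simp_all)
  obtain ⟨u, rfl⟩ : p ∣ t := hp.dvd_of_dvd_pow (ht ▸ dvd_pow_self p hj)
  have hfin : Finite {P : (curve a b).toAffine.Point // (m * (p * u)) • P = 0} := by
    apply Nat.finite_of_card_ne_zero
    rintro h0
    rw [h0] at hl
    simp at hl
    grind
  have hsub : {P : (curve a b).toAffine.Point | m • P = 0} ⊆ {P | (m * (p * u)) • P = 0} := by
    intro P hP
    simp only [Set.mem_ofPred_eq] at hP ⊢
    rw [mul_comm, mul_smul, hP, smul_zero]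
  -- Now E[m] = E[n]. A point P with mP = T is killed by n, as p ∣ t, hence by m, so T = 0.
  have heq := Set.eq_of_subset_of_ncard_le hsub h.ge (Set.finite_coe_iff.1 hfin)
  obtain ⟨P, hP⟩ := nsmul_surjective hE hm T
  have : P ∈ {P : (curve a b).toAffine.Point | m • P = 0} := by
    rw [heq, Set.mem_ofPred_eq, mul_comm, mul_smul, hP, mul_comm, mul_smul, hpT, smul_zero]
  exact hT (hP ▸ this)

/-- `Φ_n` has degree n², and `ΨSq_n` is a square, times a cubic exactly when n is even. -/
lemma odd_natDegree_Φ_add_ΨSq (hE : (curve a b).IsElliptic) {n : ℕ} (hn : 0 < n) :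
    Odd (((curve a b).Φ n).natDegree + ((curve a b).ΨSq n).natDegree) := by
  have h0 := ΨSq_ne_zero hE hn
  have h2 := two_ne_zero_of_isElliptic hE
  have h4 : (4 : K) ≠ 0 := by rw [show (4 : K) = 2 * 2 by norm_num]; exact mul_ne_zero h2 h2
  rw [WeierstrassCurve.ΨSq] at h0 ⊢
  rw [WeierstrassCurve.natDegree_Φ, natDegree_mul (left_ne_zero_of_mul h0)
    (right_ne_zero_of_mul h0), natDegree_pow, Int.natAbs_natCast]
  split_ifs with hev
  · rw [(curve a b).natDegree_Ψ₂Sq h4]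
    have : Even (n ^ 2) := ((Int.even_coe_nat n).1 hev).pow_of_ne_zero two_ne_zero
    grind
  · have : Odd (n ^ 2) := (Nat.not_even_iff_odd.1 (mt (Int.even_coe_nat n).2 hev)).pow
    rw [natDegree_one]
    grind

end Multiplicities

/-! ### From squares of rational functions to polynomial identities. -/

section RationalFunctions

lemma exists_of_isSquare_div {K : Type*} [Field K] {u v : K[X]} (hv : v ≠ 0)
    (h : IsSquare (algebraMap K[X] (RatFunc K) u / algebraMap K[X] (RatFunc K) v)) :
    ∃ A B : K[X], B ≠ 0 ∧ u * B ^ 2 = v * A ^ 2 := by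
  obtain ⟨s, hs⟩ := h
  obtain ⟨A, B, hB, rfl⟩ := IsFractionRing.div_surjective (A := K[X]) s
  have hB0 := nonZeroDivisors.ne_zero hB
  refine ⟨A, B, hB0, IsFractionRing.injective K[X] (RatFunc K) ?_⟩
  have hB' : algebraMap K[X] (RatFunc K) B ≠ 0 := by simpa using hB0
  have hv' : algebraMap K[X] (RatFunc K) v ≠ 0 := by simpa using hv
  field_simp at hs
  simpa only [map_mul, map_pow] using hs

lemma exists_torsion_of_addEquiv {M : Type*} [AddCommGroup M] {n : ℕ} (hn : n ≠ 1)
    (e : Submodule.torsionBy ℤ M n ≃+ ZMod n) : ∃ T : M, T ≠ 0 ∧ n • T = 0 := by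
  have : Nontrivial (ZMod n) := ZMod.nontrivial_iff.2 hn
  have := e.symm.injective.nontrivial
  obtain ⟨⟨T, hnT⟩, hT⟩ := exists_ne (0 : Submodule.torsionBy ℤ M n)
  exact ⟨T, by simpa using hT, by simpa using hnT⟩

open scoped Classical in
lemma eq_of_sq_of_torsion {K : Type*} [Field K] [IsAlgClosed K] {a b : K} (p : ℕ)
    [hp : Fact p.Prime] [CharP K p] (hE : (curve a b).IsElliptic) (hb : b ≠ 0)
    (hord : Nonempty (Submodule.torsionBy ℤ (WeierstrassCurve.Affine.Point
      (curve a b).toAffine) (p : ℤ) ≃+ ZMod p))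
    {m n : ℕ} (hm : 0 < m) (hn : 0 < n) {A B : K[X]} (hB : B ≠ 0)
    (h : (curve a b).Φ m * (curve a b).Φ n * B ^ 2 =
      (curve a b).ΨSq m * (curve a b).ΨSq n * A ^ 2) : m = n := by
  obtain ⟨e⟩ := hord
  obtain ⟨T, hT, hpT⟩ := exists_torsion_of_addEquiv hp.out.ne_one e
  refine eq_of_card_torsion_eq p hE hb hT hpT hm hn ?_
  rw [← card_roots_Φ hE hb hm, ← card_roots_Φ hE hb hn]
  congr 1
  ext s
  rw [Multiset.mem_toFinset, Multiset.mem_toFinset, mem_roots ((curve a b).Φ_ne_zero m),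
    mem_roots ((curve a b).Φ_ne_zero n)]
  exact ⟨eval_Φ_eq_zero_of_sq p hE hb hm hn hB h,
    eval_Φ_eq_zero_of_sq p hE hb hn hm hB (A := A) (by linear_combination h)⟩

lemma map_curve {F K : Type*} [Field F] [Field K] (φ : F →+* K) (a b : F) :
    (curve a b).map φ = curve (φ a) (φ b) := by
  ext <;> simp [curve]

lemma toRat_apply {F : Type*} [Field F] (u : F[X]) :
    toRat F u = algebraMap (AlgebraicClosure F)[X] (RatFunc (AlgebraicClosure F))
      (u.map (algebraMap F (AlgebraicClosure F))) := rfl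

/-- `Φ_{m,n}` and `Ψ_{m,n}` are not squares for distinct `m` and `n`. -/
theorem not_isSquare_Phi_and_Psi {F : Type*} [Field F] [Finite F] (a b : F)
    (hE : (curve a b).IsElliptic) (hord : IsOrdinary (curve a b))
    (hb : b ≠ 0) (m n : ℕ) (hm : 0 < m) (hn : 0 < n) (hmn : m ≠ n) :
    ¬ IsSquare (Phi a b m n) ∧ ¬ IsSquare (Psi a b m n) := by
  classical
  have hp : Fact (ringChar F).Prime := ⟨CharP.char_is_prime F _⟩
  have hchar : CharP (AlgebraicClosure F) (ringChar F) :=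
    charP_of_injective_algebraMap (algebraMap F (AlgebraicClosure F)).injective _
  have hE' : (curve (algebraMap F (AlgebraicClosure F) a)
      (algebraMap F (AlgebraicClosure F) b)).IsElliptic := by
    rw [← map_curve]
    infer_instance
  unfold IsOrdinary at hord
  rw [map_curve] at hord
  have hΦ : ∀ n : ℕ, (f a b n).map (algebraMap F (AlgebraicClosure F)) =
      (curve (algebraMap F _ a) (algebraMap F _ b)).Φ n := fun n => by
    rw [f, ← map_curve, WeierstrassCurve.map_Φ]
  have hΨ : ∀ n : ℕ, (g a b n).map (algebraMap F (AlgebraicClosure F)) =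
      (curve (algebraMap F _ a) (algebraMap F _ b)).ΨSq n := fun n => by
    rw [g, ← map_curve, WeierstrassCurve.map_ΨSq]
  have hb' : algebraMap F (AlgebraicClosure F) b ≠ 0 := by simpa using hb
  rw [Phi, Psi]
  simp only [toRat_apply, Polynomial.map_mul, hΦ, hΨ, Polynomial.map_add, Polynomial.map_pow,
    map_X, map_C]
  generalize algebraMap F (AlgebraicClosure F) a = a' at *
  generalize algebraMap F (AlgebraicClosure F) b = b' at *
  have hg := mul_ne_zero (ΨSq_ne_zero hE' hm) (ΨSq_ne_zero hE' hn)
  constructor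
  · intro hsq
    obtain ⟨A, B, hB, h⟩ := exists_of_isSquare_div hg hsq
    exact hmn (eq_of_sq_of_torsion (ringChar F) hE' hb' hord hm hn hB h)
  · intro hsq
    obtain ⟨A, B, hB, h⟩ := exists_of_isSquare_div hg hsq
    -- The cubic factor makes the degrees of the two sides of `h` differ in parity.
    have hc : (X ^ 3 + C a' * X + C b' : (AlgebraicClosure F)[X]).natDegree = 3 := by
      compute_degree!
    have hc0 : (X ^ 3 + C a' * X + C b' : (AlgebraicClosure F)[X]) ≠ 0 :=
      ne_zero_of_natDegree_gt (n := 0) (by lia)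
    have f1 := (curve a' b').Φ_ne_zero m
    have f2 := (curve a' b').Φ_ne_zero n
    have hl := mul_ne_zero (mul_ne_zero hc0 (mul_ne_zero f1 f2)) (pow_ne_zero 2 hB)
    have hr := h ▸ hl
    have hdeg := congrArg natDegree h
    rw [natDegree_mul (left_ne_zero_of_mul hl) (right_ne_zero_of_mul hl),
      natDegree_mul hc0 (mul_ne_zero f1 f2), natDegree_mul f1 f2,
      natDegree_mul (left_ne_zero_of_mul hr) (right_ne_zero_of_mul hr),
      natDegree_mul (left_ne_zero_of_mul hg) (right_ne_zero_of_mul hg), hc, natDegree_pow,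
      natDegree_pow] at hdeg
    have o1 := odd_natDegree_Φ_add_ΨSq hE' hm
    have o2 := odd_natDegree_Φ_add_ΨSq hE' hn
    grind

end RationalFunctions

end EllDivPoly

theorem lemma4 {F : Type*} [Field F] [Finite F] (a b : F)
    (hE : (EllDivPoly.curve a b).IsElliptic) (hord : EllDivPoly.IsOrdinary (EllDivPoly.curve a b))
    (hb : b ≠ 0) (m n : ℕ) (hm : 0 < m) (hn : 0 < n) (hmn : m ≠ n) :
    ¬ IsSquare (EllDivPoly.Phi a b m n) ∧ ¬ IsSquare (EllDivPoly.Psi a b m n) :=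
  EllDivPoly.not_isSquare_Phi_and_Psi a b hE hord hb m n hm hn hmn
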